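/- Let $K$ be a number field, $v$ a finite place of $K$ and $p$ the prime number below $v$; assume that $K$ contains a primitive $4$th root of unity and a primitive $p$-th root of unity. Let $E$ be an elliptic curve over $K$ with split multiplicative reduction at $v$. Let $K_v$ be the completion of $K$ at $v$, $\overline{K_v}$ an algebraic closure of $K_v$, and $|\cdot|_v$ the absolute value on $\overline{K_v}$ that extends the $v$-adic one and is normalised by $|p|_v=p^{-1}$. Let $q\in K_v^*$ with $|q|_v<1$ and let $\phi:\overline{K_v}^{\,*}\to E(\overline{K_v})$ be a surjective homomorphism of $\mathrm{Gal}(\overline{K_v}/K_v)$-modules with kernel $q^{\mathbb Z}$ (as provided by Tate's uniformization theorem). Let $l$ be a prime number, $L/K$ a finite extension and $M/L$ a Galois extension of degree $l$. Let $w$ be a place of $M$ above $v$, with absolute value $|\cdot|_w$ normalised by $|p|_w=p^{-1}$, and let $\iota_w:M\to\overline{K_v}$ be a $K$-embedding such that $|x|_w=|\iota_w(x)|_v$ for all $x\in M$; write $\iota_w$ also for the induced map $E(M)\to E(\overline{K_v})$. Let $\sigma\in\mathrm{Gal}(M/L)$ belong to the inertia group $I(w\mid w\cap L)$ and let $Q\in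 E(M)$ be such that $\sigma Q-Q$ is a torsion point. Then, for every primitive $l$-th root of unity $\zeta_l\in\overline{K_v}$, $$\iota_w(\sigma Q-Q)\in\langle\phi(\zeta_l)\rangle ,$$ and the group $\langle\phi(\zeta_l)\rangle$ does not depend on the choice of $\zeta_l$. -/

import Mathlib

open IsDedekindDomain NumberField WeierstrassCurve
open scoped Classical

noncomputable section

namespace TateLemma

/-- The residue characteristic of a finite place `v` of a number field: the prime number `p`
with `(p) = v ∩ ℤ` (see `under_int_eq`). -/
def residueChar {K : Type*} [Field K] [NumberField K] (v : HeightOneSpectrum (𝓞 K)) : ℕ :=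
  ringChar (𝓞 K ⧸ v.asIdeal)

theorem residueChar_prime {K : Type*} [Field K] [NumberField K] (v : HeightOneSpectrum (𝓞 K)) :
    (residueChar v).Prime := by
  have : Finite (𝓞 K ⧸ v.asIdeal) := v.asIdeal.finiteQuotientOfFreeOfNeBot v.ne_bot
  have : IsDomain (𝓞 K ⧸ v.asIdeal) := Ideal.Quotient.isDomain v.asIdeal
  have : CharP (𝓞 K ⧸ v.asIdeal) (residueChar v) := ringChar.charP _
  exact (CharP.char_is_prime_or_zero (𝓞 K ⧸ v.asIdeal) (residueChar v)).resolve_right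
    (CharP.char_ne_zero_of_finite (𝓞 K ⧸ v.asIdeal) (residueChar v))

theorem residueChar_mem {K : Type*} [Field K] [NumberField K] (v : HeightOneSpectrum (𝓞 K)) :
    (residueChar v : 𝓞 K) ∈ v.asIdeal := by
  rw [← Ideal.Quotient.eq_zero_iff_mem, map_natCast]
  exact ringChar.Nat.cast_ringChar

theorem under_int_eq {K : Type*} [Field K] [NumberField K] (v : HeightOneSpectrum (𝓞 K)) :
    v.asIdeal.under ℤ = Ideal.span {(residueChar v : ℤ)} := by
  have : CharP (𝓞 K ⧸ v.asIdeal) (residueChar v) := ringChar.charP _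
  ext n
  rw [Ideal.mem_span_singleton, Ideal.under_def, Ideal.mem_comap,
    ← CharP.intCast_eq_zero_iff (𝓞 K ⧸ v.asIdeal) (residueChar v),
    ← Ideal.Quotient.eq_zero_iff_mem]
  simp

/-- The exponent `s` for which `‖p‖ ^ s = p⁻¹`, where `‖·‖` is Mathlib's `v`-adic norm
(normalised by `‖π‖ = 1 / N(v)` for a uniformiser `π`) and `p` is the residue characteristic. -/
def normExp {K : Type*} [Field K] [NumberField K] (v : HeightOneSpectrum (𝓞 K)) : ℝ :=
  -Real.log (residueChar v) / Real.log (NumberField.HeightOneSpectrum.adicAbv K v (residueChar v))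

/-- The `v`-adic absolute value `|·|_v` on the number field `K`, normalised by `|p|_v = p⁻¹`. -/
def placeAbs {K : Type*} [Field K] [NumberField K] (v : HeightOneSpectrum (𝓞 K)) (x : K) : ℝ :=
  NumberField.HeightOneSpectrum.adicAbv K v x ^ normExp v

theorem adicAbv_residueChar_lt_one {K : Type*} [Field K] [NumberField K]
    (v : HeightOneSpectrum (𝓞 K)) :
    NumberField.HeightOneSpectrum.adicAbv K v (residueChar v) < 1 := by
  have h := (NumberField.FinitePlace.norm_lt_one_iff_mem K v (residueChar v : 𝓞 K)).2
    (residueChar_mem v)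
  rwa [NumberField.FinitePlace.norm_embedding, map_natCast] at h

theorem adicAbv_residueChar_pos {K : Type*} [Field K] [NumberField K]
    (v : HeightOneSpectrum (𝓞 K)) :
    0 < NumberField.HeightOneSpectrum.adicAbv K v (residueChar v) :=
  AbsoluteValue.pos _ (Nat.cast_ne_zero.2 (residueChar_prime v).ne_zero)

theorem normExp_pos {K : Type*} [Field K] [NumberField K] (v : HeightOneSpectrum (𝓞 K)) :
    0 < normExp v :=
  div_pos_of_neg_of_neg
    (neg_lt_zero.2 (Real.log_pos (by exact_mod_cast (residueChar_prime v).one_lt)))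
    (Real.log_neg (adicAbv_residueChar_pos v) (adicAbv_residueChar_lt_one v))

theorem placeAbs_residueChar {K : Type*} [Field K] [NumberField K]
    (v : HeightOneSpectrum (𝓞 K)) :
    placeAbs v (residueChar v : K) = (residueChar v : ℝ)⁻¹ := by
  have h0 := adicAbv_residueChar_pos v
  have h1 := Real.log_neg h0 (adicAbv_residueChar_lt_one v)
  have hp : (0 : ℝ) < residueChar v := by exact_mod_cast (residueChar_prime v).pos
  rw [placeAbs, Real.rpow_def_of_pos h0, normExp, mul_div_cancel₀ _ h1.ne, Real.exp_neg,
    Real.exp_log hp]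

/-- The completion `K_v`. -/
abbrev Kv {K : Type*} [Field K] [NumberField K] (v : HeightOneSpectrum (𝓞 K)) : Type _ :=
  v.adicCompletion K

/-- An algebraic closure of the completion `K_v`. -/
abbrev KvBar {K : Type*} [Field K] [NumberField K] (v : HeightOneSpectrum (𝓞 K)) : Type _ :=
  AlgebraicClosure (Kv v)

/-- The absolute value `|·|_v` on the algebraic closure of `K_v`: the unique extension (spectral
norm) of the `v`-adic absolute value of `K_v`, normalised by `|p|_v = p⁻¹`. -/
def closureAbs {K : Type*} [Field K] [NumberField K] (v : HeightOneSpectrum (𝓞 K))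
    (x : KvBar v) : ℝ :=
  spectralNorm (Kv v) (KvBar v) x ^ normExp v

theorem closureAbs_algebraMap {K : Type*} [Field K] [NumberField K]
    (v : HeightOneSpectrum (𝓞 K)) (x : K) :
    closureAbs v (algebraMap K (KvBar v) x) = placeAbs v x := by
  rw [closureAbs, placeAbs, IsScalarTower.algebraMap_apply K (Kv v) (KvBar v),
    spectralNorm_extends, ← NumberField.FinitePlace.norm_embedding]
  rfl

/-- `E` has split multiplicative reduction at `v`: over `K_v` it has a (minimal) Weierstrass
equation with split multiplicative reduction. -/
def HasSplitMultReductionAt {K : Type*} [Field K] [NumberField K] (E : WeierstrassCurve K)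
    (v : HeightOneSpectrum (𝓞 K)) : Prop :=
  ∃ C : VariableChange (Kv v),
    HasSplitMultiplicativeReduction (v.adicCompletionIntegers K) (C • E.baseChange (Kv v))

/-- `φ` is a Tate uniformisation of `E` at `v` with period `q`: a surjective homomorphism of
`Gal(K̄_v / K_v)`-modules `K̄_vˣ → E(K̄_v)` with kernel `q ^ ℤ`, where `q ∈ K_vˣ`, `|q|_v < 1`. -/
structure IsTateUniformization {K : Type*} [Field K] [NumberField K] (E : WeierstrassCurve K)
    (v : HeightOneSpectrum (𝓞 K)) (q : (Kv v)ˣ)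
    (φ : Additive (KvBar v)ˣ →+ (E.baseChange (KvBar v)).toAffine.Point) : Prop where
  abs_lt_one : closureAbs v (algebraMap (Kv v) (KvBar v) q) < 1
  surjective : Function.Surjective φ
  ker : ∀ u : (KvBar v)ˣ, φ (Additive.ofMul u) = 0 ↔
    ∃ n : ℤ, u = Units.map (algebraMap (Kv v) (KvBar v)).toMonoidHom q ^ n
  equivariant : ∀ (τ : KvBar v ≃ₐ[Kv v] KvBar v) (u : (KvBar v)ˣ),
    φ (Additive.ofMul (Units.map τ.toAlgHom.toRingHom.toMonoidHom u)) =
      Affine.Point.map (W' := E) τ.toAlgHom (φ (Additive.ofMul u))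

end TateLemma

end

/-! Since inertia preserves `w`, `σ` extends along `ι` to an automorphism `τ` of the algebraic
closure over `K_v` (`exists_algEquiv_of_spectralAbs_eq`). Lift `ι Q` to `u` and put `t = τ u / u`,
so that `φ t = ι (σ Q - Q)`. As `|t| = 1`, and `q ^ ℤ` meets the elements of absolute value 1 only
in 1, relations between points lift to exact relations in the multiplicative group: `t` is a root of
unity, it is fixed by every automorphism fixing `ι M`, and since `σ ^ l = 1` the product of the
`τ^[i] t`, `i < l`, telescopes to 1.

It remains to deduce `t ^ l = 1` (`Units.pow_eq_one_of_norm_eq_one`). The prime-to-`p` part of `t`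
is fixed by `τ`, because inertia acts trivially on the residue field and roots of unity of order
prime to `p` inject into it; so its norm is its `l`-th power. On the `p`-part `τ` acts as raising to
a power `a`, and the roots of unity in `K` force `a ≡ 1` mod `p`, and mod 4 if `p = 2` and the order
is divisible by 4. Then a power of `p` dividing `1 + a + ⋯ + a ^ (l - 1)` already divides `l`. -/

/-! ### Geometric sums and roots of unity. -/

theorem Nat.geom_sum_modEq_of_modEq_one {a m : ℕ} (h : a ≡ 1 [MOD m]) (l : ℕ) :
    ∑ i ∈ Finset.range l, a ^ i ≡ l [MOD m] := by
  induction l with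
  | zero => rfl
  | succ l ih =>
    rw [Finset.sum_range_succ]
    exact ih.add ((h.pow l).trans (by rw [one_pow]))

/-- The case `k ≥ 2` cannot occur: `p ∣ l` forces `p = l`, and then the sum is congruent to `p` mod
`p ^ 2`. For `p = 2` this needs `a ≡ 1` mod 4. -/
theorem Nat.prime_pow_dvd_of_dvd_geom_sum {p l : ℕ} (hp : p.Prime) (hl : l.Prime) {a k : ℕ}
    (ha : 1 ≤ k → a ≡ 1 [MOD p]) (ha4 : p = 2 → 2 ≤ k → a ≡ 1 [MOD 4])
    (h : p ^ k ∣ ∑ i ∈ Finset.range l, a ^ i) : p ^ k ∣ l := by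
  rcases Nat.lt_or_ge k 2 with hk | hk
  · interval_cases k
    · simp
    · rw [pow_one] at h ⊢
      exact ((Nat.geom_sum_modEq_of_modEq_one (ha le_rfl) l).dvd_iff dvd_rfl).1 h
  · exfalso
    have hpS : p ∣ ∑ i ∈ Finset.range l, a ^ i := (dvd_pow_self p (by omega)).trans h
    have hp2 : p ^ 2 ∣ ∑ i ∈ Finset.range l, a ^ i := (pow_dvd_pow p hk).trans h
    have ha1 := ha (by omega)
    have hpl : p ∣ l := ((Nat.geom_sum_modEq_of_modEq_one ha1 l).dvd_iff dvd_rfl).1 hpS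
    obtain rfl : p = l := (Nat.prime_dvd_prime_iff_eq hp hl).1 hpl
    rcases hp.eq_two_or_odd' with rfl | hodd
    · have := ((Nat.geom_sum_modEq_of_modEq_one (ha4 rfl hk) 2).dvd_iff dvd_rfl).1
        (by simpa using hp2)
      omega
    · obtain ⟨b, hb⟩ := (Nat.modEq_iff_dvd.1 ha1.symm : (p : ℤ) ∣ (a : ℤ) - (1 : ℕ))
      have h1 := odd_sq_dvd_geom_sum₂_sub (1 : ℤ) b hodd
      rw [show (1 : ℤ) + p * b = a by rw [← hb]; push_cast; ring] at h1
      simp only [one_pow, mul_one] at h1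
      have h2 : (p : ℤ) ^ 2 ∣ ∑ i ∈ Finset.range p, (a : ℤ) ^ i := by exact_mod_cast hp2
      have h3 : (p : ℤ) ^ 2 ∣ p := (dvd_sub_right h2).1 h1
      have h4 := Nat.le_of_dvd hp.pos (by exact_mod_cast h3 : p ^ 2 ∣ p)
      nlinarith [hp.two_le]

/-- If `ζ ≠ 1`, the sum of the `ζ ^ i`, `i < N`, vanishes; but each term is congruent to 1 modulo
the maximal ideal, so the sum is congruent to the unit `N`. -/
theorem AbsoluteValue.eq_one_of_pow_eq_one {Ω : Type*} [Field Ω] {A : AbsoluteValue Ω ℝ}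
    (hA : IsNonarchimedean A) {N : ℕ} (hN : A N = 1) {ζ : Ω} (hζ : ζ ^ N = 1)
    (h1 : A (ζ - 1) < 1) : ζ = 1 := by
  by_contra hne
  have hζ1 : A ζ ≤ 1 := by
    have := hA (ζ - 1) 1
    simp only [sub_add_cancel, map_one] at this
    exact this.trans (max_le h1.le le_rfl)
  have hpow : ∀ i : ℕ, A (ζ ^ i - 1) < 1 := by
    intro i
    induction i with
    | zero => simp
    | succ i ih =>
      have h2 : ζ ^ (i + 1) - 1 = ζ * (ζ ^ i - 1) + (ζ - 1) := by ring
      rw [h2]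
      refine (hA _ _).trans_lt (max_lt ?_ h1)
      rw [map_mul]
      exact (mul_le_of_le_one_left (A.nonneg _) hζ1).trans_lt ih
  have hsum : ∀ n : ℕ, A (∑ i ∈ Finset.range n, (ζ ^ i - 1)) < 1 := by
    intro n
    induction n with
    | zero => simp
    | succ n ih =>
      rw [Finset.sum_range_succ]
      exact (hA _ _).trans_lt (max_lt ih (hpow n))
  have hz : ∑ i ∈ Finset.range N, ζ ^ i = 0 := by
    have := geom_sum_mul ζ N
    rw [hζ, sub_self] at this
    exact (mul_eq_zero.1 this).resolve_right (sub_ne_zero.2 hne)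
  have := hsum N
  rw [Finset.sum_sub_distrib, hz] at this
  simp [hN] at this

/-- Let `τ` be an endomorphism of the units which fixes the powers of `t` of order prime to `p`,
the `p`-th roots of unity and, if `p = 2`, the fourth ones. If `t` has finite order and
`t * τ t * ⋯ * τ^[l - 1] t = 1`, then `t ^ l = 1`. -/
theorem Units.pow_eq_one_of_norm_eq_one {Ω : Type*} [Field Ω] {p l : ℕ} (hp : p.Prime)
    (hl : l.Prime) (τ : Ωˣ →* Ωˣ) {t : Ωˣ} (ht : IsOfFinOrder t)
    (hnorm : ∏ i ∈ Finset.range l, τ^[i] t = 1)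
    (hprime : ∀ (j N : ℕ), N.Coprime p → (t ^ j) ^ N = 1 → τ (t ^ j) = t ^ j)
    (hτp : ∀ x : Ωˣ, x ^ p = 1 → τ x = x)
    (hτ4 : p = 2 → ∀ x : Ωˣ, x ^ 4 = 1 → τ x = x) : t ^ l = 1 := by
  have hn := ht.orderOf_pos
  obtain ⟨k, m, hm, hkm⟩ := Nat.exists_eq_pow_mul_and_not_dvd hn.ne' p hp.ne_one
  have hcop : Nat.Coprime (p ^ k) m :=
    Nat.Coprime.pow_left k ((Nat.Prime.coprime_iff_not_dvd hp).2 hm)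
  have hm0 : m ≠ 0 := by rintro rfl; simp at hm
  have htn : t ^ (p ^ k * m) = 1 := by rw [← hkm]; exact pow_orderOf_eq_one t
  have hy : (t ^ p ^ k) ^ l = 1 := by
    have hfix : τ (t ^ p ^ k) = t ^ p ^ k :=
      hprime _ m (((Nat.Prime.coprime_iff_not_dvd hp).2 hm).symm) (by rw [← pow_mul, htn])
    have hit : ∀ i : ℕ, τ^[i] (t ^ p ^ k) = t ^ p ^ k := by
      intro i
      induction i with
      | zero => rfl
      | succ i ih => rw [Function.iterate_succ_apply, hfix, ih]
    have h2 := congrArg (· ^ p ^ k) hnorm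
    simp only [← Finset.prod_pow, ← iterate_map_pow, hit, one_pow, Finset.prod_const,
      Finset.card_range] at h2
    exact h2
  have hx : (t ^ m) ^ l = 1 := by
    set x := t ^ m with hxdef
    have hxo : orderOf x = p ^ k := by
      rw [hxdef, orderOf_pow' t hm0, hkm, Nat.gcd_eq_right (_root_.dvd_mul_left m _),
        Nat.mul_div_cancel _ (Nat.pos_of_ne_zero hm0)]
    have hxk : x ^ p ^ k = 1 := by rw [← hxo]; exact pow_orderOf_eq_one x
    have : NeZero (p ^ k) := ⟨(pow_pos hp.pos k).ne'⟩
    have hprim : IsPrimitiveRoot x (p ^ k) := hxo ▸ IsPrimitiveRoot.orderOf x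
    obtain ⟨a, -, ha⟩ := hprim.eq_pow_of_mem_rootsOfUnity
      ((mem_rootsOfUnity (p ^ k) (τ x)).2 (by rw [← map_pow, hxk, map_one]))
    have hit : ∀ i : ℕ, τ^[i] x = x ^ a ^ i := by
      intro i
      induction i with
      | zero => simp
      | succ i ih => rw [Function.iterate_succ_apply', ih, map_pow, ← ha, ← pow_mul, pow_succ']
    have h2 := congrArg (· ^ m) hnorm
    simp only [← Finset.prod_pow, ← iterate_map_pow, one_pow] at h2
    simp only [← hxdef, hit, Finset.prod_pow_eq_pow_sum] at h2
    -- The element `x ^ p ^ (k - r)` has order `p ^ r`; if `τ` fixes it, then `a ≡ 1` modulo that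
    -- order.
    have hmod : ∀ r ≤ k, (∀ z : Ωˣ, z ^ p ^ r = 1 → τ z = z) → a ≡ 1 [MOD p ^ r] := by
      intro r hr hz
      have h3 := hz (x ^ p ^ (k - r))
        (by rw [← pow_mul, ← pow_add, Nat.sub_add_cancel hr, hxk])
      rw [map_pow, ← ha, ← pow_mul] at h3
      have h4 : a * p ^ (k - r) ≡ 1 * p ^ (k - r) [MOD p ^ r * p ^ (k - r)] := by
        rw [← pow_add, Nat.add_sub_cancel' hr, ← hxo, one_mul]
        exact pow_eq_pow_iff_modEq.1 h3
      exact Nat.ModEq.mul_right_cancel' (pow_pos hp.pos _).ne' h4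
    obtain ⟨c, hc⟩ := Nat.prime_pow_dvd_of_dvd_geom_sum hp hl (a := a) (k := k)
      (fun hk ↦ by simpa using hmod 1 hk (by simpa using hτp))
      (fun h2 hk ↦ by simpa [h2] using hmod 2 hk (by simpa [h2] using hτ4 h2))
      (hxo ▸ orderOf_dvd_of_pow_eq_one h2)
    rw [hc, pow_mul, hxk, one_pow]
  rw [← pow_mul, mul_comm, pow_mul] at hx hy
  -- The order of `t ^ l` divides both `p ^ k` and `m`, which are coprime.
  have h := Nat.dvd_gcd (orderOf_dvd_of_pow_eq_one hy) (orderOf_dvd_of_pow_eq_one hx)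
  rw [hcop] at h
  exact orderOf_eq_one_iff.1 (Nat.dvd_one.1 h)

/-! ### The absolute value on the algebraic closure of `K_v`. -/

namespace TateLemma

variable {K : Type*} [Field K] [NumberField K] (v : HeightOneSpectrum (𝓞 K))

instance : CharZero (Kv v) := charZero_of_injective_algebraMap (algebraMap K (Kv v)).injective

theorem norm_algebraMap_Kv (x : K) :
    ‖algebraMap K (Kv v) x‖ = NumberField.HeightOneSpectrum.adicAbv K v x :=
  NumberField.FinitePlace.norm_embedding v x

/-- The norm of `K_v` is nontrivial. -/
@[reducible]
noncomputable def nontriviallyNormedFieldKv : NontriviallyNormedField (Kv v) :=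
  NontriviallyNormedField.ofNormNeOne ⟨algebraMap K (Kv v) (residueChar v),
    (map_ne_zero _).2 (Nat.cast_ne_zero.2 (residueChar_prime v).ne_zero), by
      rw [norm_algebraMap_Kv]
      exact (adicAbv_residueChar_lt_one v).ne⟩

/-- The spectral norm of the algebraic closure of `K_v` as an absolute value. -/
noncomputable def spectralAbs : AbsoluteValue (KvBar v) ℝ where
  toFun := spectralNorm (Kv v) (KvBar v)
  map_mul' x y := by
    let _ := nontriviallyNormedFieldKv v
    exact spectralAlgNorm_mul (K := Kv v) (L := KvBar v) x y
  nonneg' x := spectralNorm_nonneg x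
  eq_zero' x := ⟨fun h ↦ eq_zero_of_map_spectralNorm_eq_zero h (Algebra.IsAlgebraic.isAlgebraic x),
    fun h ↦ by rw [h]; exact spectralNorm_zero⟩
  add_le' x y := (isNonarchimedean_spectralNorm x y).trans
    (max_le_add_of_nonneg (spectralNorm_nonneg x) (spectralNorm_nonneg y))

theorem isNonarchimedean_spectralAbs : IsNonarchimedean (spectralAbs v) :=
  isNonarchimedean_spectralNorm (K := Kv v) (L := KvBar v)

theorem spectralAbs_algebraMap (x : Kv v) : spectralAbs v (algebraMap (Kv v) (KvBar v) x) = ‖x‖ :=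
  spectralNorm_extends x

theorem spectralAbs_algEquiv (τ : KvBar v ≃ₐ[Kv v] KvBar v) (x : KvBar v) :
    spectralAbs v (τ x) = spectralAbs v x :=
  (spectralNorm_eq_of_equiv τ x).symm

theorem closureAbs_eq (x : KvBar v) : closureAbs v x = spectralAbs v x ^ normExp v := rfl

theorem closureAbs_lt_one_iff (x : KvBar v) : closureAbs v x < 1 ↔ spectralAbs v x < 1 :=
  Real.rpow_lt_one_iff' ((spectralAbs v).nonneg x) (normExp_pos v)

theorem closureAbs_le_one_iff (x : KvBar v) : closureAbs v x ≤ 1 ↔ spectralAbs v x ≤ 1 := by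
  have h := Real.rpow_le_rpow_iff ((spectralAbs v).nonneg x) zero_le_one (normExp_pos v)
  rwa [Real.one_rpow] at h

theorem closureAbs_inj {x y : KvBar v} :
    closureAbs v x = closureAbs v y ↔ spectralAbs v x = spectralAbs v y :=
  Real.rpow_left_inj ((spectralAbs v).nonneg x) ((spectralAbs v).nonneg y) (normExp_pos v).ne'

theorem placeAbs_lt_one_iff (x : K) :
    placeAbs v x < 1 ↔ NumberField.HeightOneSpectrum.adicAbv K v x < 1 :=
  Real.rpow_lt_one_iff' (AbsoluteValue.nonneg _ x) (normExp_pos v)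

theorem placeAbs_le_one_iff (x : K) :
    placeAbs v x ≤ 1 ↔ NumberField.HeightOneSpectrum.adicAbv K v x ≤ 1 := by
  have h := Real.rpow_le_rpow_iff
    ((NumberField.HeightOneSpectrum.adicAbv K v).nonneg x) zero_le_one (normExp_pos v)
  rwa [Real.one_rpow] at h

theorem spectralAbs_natCast_eq_one {N : ℕ} (hN : N.Coprime (residueChar v)) :
    spectralAbs v (N : KvBar v) = 1 := by
  rw [← map_natCast (algebraMap (Kv v) (KvBar v)), spectralAbs_algebraMap,
    ← map_natCast (algebraMap K (Kv v)), norm_algebraMap_Kv, ← map_natCast (algebraMap (𝓞 K) K),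
    ← NumberField.FinitePlace.norm_embedding,
    NumberField.FinitePlace.norm_eq_one_iff_notMem]
  intro h
  refine v.isPrime.ne_top ((Ideal.eq_top_iff_one _).2 ?_)
  have h1 : ((N.gcd (residueChar v) : ℤ) : 𝓞 K) = 1 := by rw [hN]; simp
  rw [← h1, Nat.gcd_eq_gcd_ab]
  push_cast
  exact v.asIdeal.add_mem (v.asIdeal.mul_mem_right _ h)
    (v.asIdeal.mul_mem_right _ (residueChar_mem v))

/-- Density of `K` in `K_v`, applied to each coefficient; the bound `B` makes the estimate uniform
in `β`. -/
theorem exists_polynomial_approx (B : ℝ) {ε : ℝ} (hε : 0 < ε) (f : Polynomial (Kv v)) :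
    ∃ g : Polynomial K, ∀ β : KvBar v, spectralAbs v β ≤ B →
      spectralAbs v (Polynomial.aeval β f - Polynomial.aeval β g) < ε := by
  induction f using Polynomial.induction_on' with
  | add f₁ f₂ h₁ h₂ =>
    obtain ⟨g₁, h₁⟩ := h₁
    obtain ⟨g₂, h₂⟩ := h₂
    refine ⟨g₁ + g₂, fun β hβ ↦ ?_⟩
    rw [map_add, map_add, add_sub_add_comm]
    exact (isNonarchimedean_spectralAbs v _ _).trans_lt (max_lt (h₁ β hβ) (h₂ β hβ))
  | monomial n c =>
    have hC : 0 < max B 0 ^ n + 1 := by positivity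
    obtain ⟨d, hd⟩ := (HeightOneSpectrum.denseRange_algebraMap K v).exists_dist_lt c
      (div_pos hε hC)
    refine ⟨Polynomial.monomial n d, fun β hβ ↦ ?_⟩
    rw [Polynomial.aeval_monomial, Polynomial.aeval_monomial,
      IsScalarTower.algebraMap_apply K (Kv v) (KvBar v), ← sub_mul, ← map_sub, map_mul, map_pow,
      spectralAbs_algebraMap, ← dist_eq_norm]
    have h1 : spectralAbs v β ^ n ≤ max B 0 ^ n :=
      pow_le_pow_left₀ ((spectralAbs v).nonneg β) (hβ.trans (le_max_left _ _)) n
    rw [lt_div_iff₀ hC] at hd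
    nlinarith [dist_nonneg (x := c) (y := algebraMap K (Kv v) d)]

/-! ### Inertia and the `w`-adic absolute value. -/

section Inertia

open scoped Pointwise

variable {L M : Type*} [Field L] [Field M] [NumberField M] [Algebra L M]
  (w : HeightOneSpectrum (𝓞 M)) {σ : Gal(M/L)}

theorem intValuation_smul_le (hσ : σ ∈ w.asIdeal.inertia Gal(M/L)) (a : 𝓞 M) :
    w.intValuation (σ • a) ≤ w.intValuation a := by
  rcases eq_or_ne a 0 with rfl | ha
  · simp
  · have h := w.intValuation_if_neg ha
    have hmem := (w.intValuation_le_pow_iff_mem a _).1 h.le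
    rw [h, w.intValuation_le_pow_iff_mem]
    have hst : σ • w.asIdeal = w.asIdeal := Ideal.inertia_le_stabilizer w.asIdeal hσ
    have hmem' := Ideal.smul_mem_pointwise_smul_iff (a := σ) |>.2 hmem
    rwa [smul_pow', hst] at hmem'

theorem intValuation_smul (hσ : σ ∈ w.asIdeal.inertia Gal(M/L)) (a : 𝓞 M) :
    w.intValuation (σ • a) = w.intValuation a := by
  refine le_antisymm (intValuation_smul_le w hσ a) ?_
  simpa using intValuation_smul_le w (inv_mem hσ) (σ • a)

theorem adicAbv_apply_of_mem_inertia (hσ : σ ∈ w.asIdeal.inertia Gal(M/L)) (x : M) :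
    NumberField.HeightOneSpectrum.adicAbv M w (σ x) =
      NumberField.HeightOneSpectrum.adicAbv M w x := by
  have hint (a : 𝓞 M) : NumberField.HeightOneSpectrum.adicAbv M w (σ (algebraMap (𝓞 M) M a)) =
      NumberField.HeightOneSpectrum.adicAbv M w (algebraMap (𝓞 M) M a) := by
    rw [show σ (algebraMap (𝓞 M) M a) = algebraMap (𝓞 M) M (σ • a) from rfl,
      NumberField.HeightOneSpectrum.adicAbv_def, NumberField.HeightOneSpectrum.adicAbv_def,
      w.valuation_of_algebraMap, w.valuation_of_algebraMap, intValuation_smul w hσ]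
  obtain ⟨a, b, -, rfl⟩ := IsFractionRing.div_surjective (A := 𝓞 M) x
  rw [map_div₀, map_div₀, map_div₀, hint, hint]

/-- Passes from the ring of integers, where the bound defines inertia, to all `w`-integral elements,
by writing `x` as a fraction whose denominator is prime to `w`. -/
theorem adicAbv_sub_lt_one_of_mem_inertia (hσ : σ ∈ w.asIdeal.inertia Gal(M/L)) {x : M}
    (hx : NumberField.HeightOneSpectrum.adicAbv M w x ≤ 1) :
    NumberField.HeightOneSpectrum.adicAbv M w (σ x - x) < 1 := by
  have hv : w.valuation M x ≤ 1 := by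
    rwa [NumberField.HeightOneSpectrum.adicAbv_def, NNReal.coe_le_one,
      WithZeroMulInt.toNNReal_le_one_iff (NumberField.HeightOneSpectrum.one_lt_absNorm_nnreal w)]
      at hx
  obtain ⟨n, ⟨d, hd⟩, hnd⟩ := w.exists_primeCompl_mul_eq_of_integer x hv
  have hint (a : 𝓞 M) : NumberField.HeightOneSpectrum.adicAbv M w
      (σ (algebraMap (𝓞 M) M a) - algebraMap (𝓞 M) M a) < 1 := by
    rw [show σ (algebraMap (𝓞 M) M a) = algebraMap (𝓞 M) M (σ • a) from rfl, ← map_sub,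
      ← NumberField.FinitePlace.norm_embedding, NumberField.FinitePlace.norm_lt_one_iff_mem]
    exact hσ a
  have hd1 : NumberField.HeightOneSpectrum.adicAbv M w (algebraMap (𝓞 M) M d) = 1 := by
    rw [← NumberField.FinitePlace.norm_embedding, NumberField.FinitePlace.norm_eq_one_iff_notMem]
    exact hd
  have key : (σ x - x) * σ (algebraMap (𝓞 M) M d) =
      (σ (algebraMap (𝓞 M) M n) - algebraMap (𝓞 M) M n) +
        (-x) * (σ (algebraMap (𝓞 M) M d) - algebraMap (𝓞 M) M d) := by
    rw [← hnd, map_mul]; ring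
  have h := congrArg (NumberField.HeightOneSpectrum.adicAbv M w) key
  rw [map_mul, adicAbv_apply_of_mem_inertia w hσ, hd1, mul_one] at h
  rw [h]
  refine (NumberField.HeightOneSpectrum.isNonarchimedean_adicAbv M w _ _).trans_lt
    (max_lt (hint n) ?_)
  rw [map_mul, AbsoluteValue.map_neg]
  exact (mul_le_of_le_one_left (AbsoluteValue.nonneg _ _) hx).trans_lt (hint d)

end Inertia

theorem exists_forall_exists_aeval_eq (K M : Type*) [Field K] [Field M] [Algebra K M]
    [FiniteDimensional K M] [Algebra.IsSeparable K M] :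
    ∃ α : M, ∀ x : M, ∃ g : Polynomial K, Polynomial.aeval α g = x := by
  obtain ⟨α, hα⟩ := Field.exists_primitive_element K M
  refine ⟨α, fun x ↦ ?_⟩
  have hx : x ∈ (IntermediateField.adjoin K {α}).toSubalgebra := by rw [hα]; trivial
  rw [IntermediateField.adjoin_simple_toSubalgebra_of_isAlgebraic (Algebra.IsAlgebraic.isAlgebraic α),
    Algebra.adjoin_singleton_eq_range_aeval] at hx
  exact hx

/-! ### Embeddings of `M` and approximation by `K`-polynomials. -/

section Extension

variable {K M : Type*} [Field K] [NumberField K] [Field M] [Algebra K M]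
  (v : HeightOneSpectrum (𝓞 K))

theorem aeval_algHom_apply_KvBar (ι : M →ₐ[K] KvBar v) (α : M) (g : Polynomial K) :
    Polynomial.aeval (ι α) g = ι (Polynomial.aeval α g) :=
  Polynomial.aeval_algHom_apply ι α g

variable [FiniteDimensional K M]

/-- Two embeddings of `M` in the algebraic closure of `K_v` which induce the same absolute value
are conjugate over `K_v`. -/
theorem exists_algEquiv_of_spectralAbs_eq (ι ι' : M →ₐ[K] KvBar v)
    (h : ∀ x, spectralAbs v (ι' x) = spectralAbs v (ι x)) :
    ∃ τ : KvBar v ≃ₐ[Kv v] KvBar v, ∀ x, τ (ι x) = ι' x := by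
  obtain ⟨α, hα⟩ := exists_forall_exists_aeval_eq K M
  -- A polynomial `g` over `K` close to the minimal polynomial is small at `ι α`, hence equally
  -- small at `ι' α`, as both embeddings induce the same absolute value. So the minimal polynomial
  -- vanishes at `ι' α`.
  have h0 : Polynomial.aeval (ι' α) (minpoly (Kv v) (ι α)) = 0 := by
    by_contra hne
    obtain ⟨g, hg⟩ := exists_polynomial_approx v (spectralAbs v (ι α))
      ((spectralAbs v).pos hne) (minpoly (Kv v) (ι α))
    have h1 := hg (ι α) le_rfl
    have h2 := hg (ι' α) (h α).le
    rw [minpoly.aeval, zero_sub, AbsoluteValue.map_neg, aeval_algHom_apply_KvBar, ← h] at h1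
    rw [aeval_algHom_apply_KvBar] at h2
    have h3 := isNonarchimedean_spectralAbs v (Polynomial.aeval (ι' α) (minpoly (Kv v) (ι α)) -
      ι' (Polynomial.aeval α g)) (ι' (Polynomial.aeval α g))
    rw [sub_add_cancel] at h3
    exact (h3.trans_lt (max_lt h2 h1)).false
  obtain ⟨τ, hτ⟩ := ((isConjRoot_of_aeval_eq_zero
    (Algebra.IsIntegral.isIntegral (ι α)) h0).symm).exists_algEquiv
  refine ⟨τ, fun x ↦ ?_⟩
  obtain ⟨g, rfl⟩ := hα x
  rw [← aeval_algHom_apply_KvBar, ← aeval_algHom_apply_KvBar, ← hτ]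
  exact (Polynomial.aeval_algHom_apply (τ.toAlgHom.restrictScalars K) (ι α) g).symm

/-- An element fixed by the absolute Galois group of `K_v · M` is a limit of elements of `M`. -/
theorem exists_spectralAbs_sub_lt (ι : M →ₐ[K] KvBar v) {t : KvBar v}
    (ht : ∀ τ : KvBar v ≃ₐ[Kv v] KvBar v, (∀ x, τ (ι x) = ι x) → τ t = t) {ε : ℝ} (hε : 0 < ε) :
    ∃ x : M, spectralAbs v (t - ι x) < ε := by
  obtain ⟨α, hα⟩ := exists_forall_exists_aeval_eq K M
  -- Galois correspondence: fixing `ι α` amounts to fixing `ι M`.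
  have hmem : t ∈ IntermediateField.adjoin (Kv v) {ι α} := by
    rw [← InfiniteGalois.fixedField_fixingSubgroup (IntermediateField.adjoin (Kv v) {ι α}),
      IntermediateField.mem_fixedField_iff]
    intro τ hτ
    refine ht τ fun x ↦ ?_
    obtain ⟨g, rfl⟩ := hα x
    have h1 : τ (ι α) = ι α := (IntermediateField.mem_fixingSubgroup_iff _ _).1 hτ _
      (IntermediateField.mem_adjoin_simple_self _ _)
    rw [← aeval_algHom_apply_KvBar]
    refine (Polynomial.aeval_algHom_apply (τ.toAlgHom.restrictScalars K) (ι α) g).symm.trans ?_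
    exact congrArg (Polynomial.aeval · g) h1
  rw [← IntermediateField.mem_toSubalgebra, IntermediateField.adjoin_simple_toSubalgebra_of_isAlgebraic
    (Algebra.IsAlgebraic.isAlgebraic _), Algebra.adjoin_singleton_eq_range_aeval] at hmem
  obtain ⟨f, rfl⟩ := hmem
  obtain ⟨g, hg⟩ := exists_polynomial_approx v (spectralAbs v (ι α)) hε f
  refine ⟨Polynomial.aeval α g, ?_⟩
  rw [← aeval_algHom_apply_KvBar]
  exact hg _ le_rfl

end Extension

/-! ### Galois action and the Tate uniformisation. -/

variable {K : Type*} [Field K] [NumberField K] {v : HeightOneSpectrum (𝓞 K)}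

/-- The action of an automorphism of the algebraic closure of `K_v` on the units. -/
noncomputable abbrev unitsAut (τ : KvBar v ≃ₐ[Kv v] KvBar v) : (KvBar v)ˣ →* (KvBar v)ˣ :=
  Units.map τ.toAlgHom.toRingHom.toMonoidHom

theorem coe_unitsAut (τ : KvBar v ≃ₐ[Kv v] KvBar v) (u : (KvBar v)ˣ) :
    (unitsAut τ u : KvBar v) = τ u := rfl

theorem spectralAbs_units_ne_zero (u : (KvBar v)ˣ) : spectralAbs v (u : KvBar v) ≠ 0 :=
  (spectralAbs v).ne_zero u.ne_zero

theorem spectralAbs_unitsAut_div (τ : KvBar v ≃ₐ[Kv v] KvBar v) (u : (KvBar v)ˣ) :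
    spectralAbs v ((unitsAut τ u / u : (KvBar v)ˣ) : KvBar v) = 1 := by
  rw [Units.val_div_eq_div_val, map_div₀, coe_unitsAut, spectralAbs_algEquiv,
    div_self (spectralAbs_units_ne_zero u)]

theorem unitsAut_pow_apply (τ : KvBar v ≃ₐ[Kv v] KvBar v) (n : ℕ) (u : (KvBar v)ˣ) :
    unitsAut (τ ^ n) u = (unitsAut τ)^[n] u := by
  induction n with
  | zero => ext; rfl
  | succ n ih =>
    rw [Function.iterate_succ_apply', ← ih, pow_succ']
    ext; rfl

theorem unitsAut_eq_of_pow_eq_one {r : ℕ} [NeZero r] (hr : ∃ ζ : K, IsPrimitiveRoot ζ r)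
    (τ : KvBar v ≃ₐ[Kv v] KvBar v) {x : (KvBar v)ˣ} (hx : x ^ r = 1) : unitsAut τ x = x := by
  obtain ⟨ζ, hζ⟩ := hr
  have h1 := hζ.map_of_injective (f := algebraMap K (KvBar v)) (algebraMap K (KvBar v)).injective
  obtain ⟨i, -, hi⟩ := h1.eq_pow_of_pow_eq_one (ξ := (x : KvBar v))
    (by rw [← Units.val_pow_eq_pow_val, hx, Units.val_one])
  ext
  rw [coe_unitsAut, ← hi, ← map_pow, IsScalarTower.algebraMap_apply K (Kv v) (KvBar v)]
  exact τ.commutes _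

variable {E : WeierstrassCurve K} {q : (Kv v)ˣ}
  {φ : Additive (KvBar v)ˣ →+ (E.baseChange (KvBar v)).toAffine.Point}

theorem IsTateUniformization.eq_one_of_map_eq_zero (hφ : IsTateUniformization E v q φ)
    {u : (KvBar v)ˣ} (hu : φ (Additive.ofMul u) = 0) (habs : spectralAbs v (u : KvBar v) = 1) :
    u = 1 := by
  obtain ⟨n, rfl⟩ := (hφ.ker u).1 hu
  have hq := (closureAbs_lt_one_iff v _).1 hφ.abs_lt_one
  rw [Units.val_zpow_eq_zpow_val, map_zpow₀] at habs
  have hn := (zpow_eq_one_iff_right₀ ((spectralAbs v).nonneg _) hq.ne).1 habs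
  rw [hn, zpow_zero]

/-- A priori `τ u / u` is only a power of `q`; having absolute value 1, it is 1. -/
theorem IsTateUniformization.unitsAut_eq_of_map_eq (hφ : IsTateUniformization E v q φ)
    {τ : KvBar v ≃ₐ[Kv v] KvBar v} {u : (KvBar v)ˣ}
    (h : Affine.Point.map (W' := E) τ.toAlgHom (φ (Additive.ofMul u)) = φ (Additive.ofMul u)) :
    unitsAut τ u = u := by
  rw [← div_eq_one]
  refine hφ.eq_one_of_map_eq_zero ?_ (spectralAbs_unitsAut_div τ u)
  rw [ofMul_div, map_sub, hφ.equivariant, h, sub_self]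

theorem point_map_algEquiv {L M : Type*} [Field L] [Field M] [Algebra K L] [Algebra K M]
    [Algebra L M] [IsScalarTower K L M] (ι : M →ₐ[K] KvBar v) (σ : M →ₐ[L] M)
    {τ : KvBar v ≃ₐ[Kv v] KvBar v} (hτ : ∀ x, τ (ι x) = ι (σ x))
    (P : (E.baseChange M).toAffine.Point) :
    Affine.Point.map (W' := E) τ.toAlgHom (Affine.Point.map (W' := E) ι P) =
      Affine.Point.map (W' := E) ι (Affine.Point.map (W' := E) σ P) := by
  rcases P with _ | ⟨x, y, h⟩
  · rfl
  · simp only [Affine.Point.map_some, Affine.Point.some.injEq]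
    exact ⟨hτ x, hτ y⟩

/-- Extends the inertia congruence from `ι M` to its limits, by approximating `s` within distance
less than 1. -/
theorem spectralAbs_sub_lt_one_of_mem_inertia {L M : Type*} [Field L] [Field M] [NumberField M]
    [Algebra K M] [Algebra L M] {w : HeightOneSpectrum (𝓞 M)} {ι : M →ₐ[K] KvBar v}
    (hι : ∀ x : M, placeAbs w x = closureAbs v (ι x)) {σ : Gal(M/L)}
    (hσ : σ ∈ w.asIdeal.inertia Gal(M/L)) {τ : KvBar v ≃ₐ[Kv v] KvBar v}
    (hτ : ∀ x, τ (ι x) = ι (σ x)) {s : KvBar v} (hs : spectralAbs v s ≤ 1)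
    (hs' : ∀ τ' : KvBar v ≃ₐ[Kv v] KvBar v, (∀ x, τ' (ι x) = ι x) → τ' s = s) :
    spectralAbs v (τ s - s) < 1 := by
  have hna := isNonarchimedean_spectralAbs v
  have : FiniteDimensional K M := Module.Finite.of_restrictScalars_finite ℚ K M
  obtain ⟨x, hx⟩ := exists_spectralAbs_sub_lt v ι hs' one_pos
  have hx' : spectralAbs v (ι x - s) < 1 := by rwa [AbsoluteValue.map_sub]
  have hx1 : spectralAbs v (ι x) ≤ 1 := by
    have := hna (ι x - s) s
    rw [sub_add_cancel] at this
    exact this.trans (max_le hx'.le hs)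
  rw [← closureAbs_le_one_iff, ← hι, placeAbs_le_one_iff] at hx1
  have h1 := adicAbv_sub_lt_one_of_mem_inertia w hσ hx1
  rw [← placeAbs_lt_one_iff, hι, closureAbs_lt_one_iff, map_sub, ← hτ] at h1
  have key : τ s - s = τ (s - ι x) + ((τ (ι x) - ι x) + (ι x - s)) := by rw [map_sub]; ring
  rw [key]
  refine (hna _ _).trans_lt (max_lt (by rwa [spectralAbs_algEquiv]) ?_)
  exact (hna _ _).trans_lt (max_lt h1 hx')

theorem unitsAut_eq_of_mem_inertia {L M : Type*} [Field L] [Field M] [NumberField M]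
    [Algebra K M] [Algebra L M] {w : HeightOneSpectrum (𝓞 M)} {ι : M →ₐ[K] KvBar v}
    (hι : ∀ x : M, placeAbs w x = closureAbs v (ι x)) {σ : Gal(M/L)}
    (hσ : σ ∈ w.asIdeal.inertia Gal(M/L)) {τ : KvBar v ≃ₐ[Kv v] KvBar v}
    (hτ : ∀ x, τ (ι x) = ι (σ x)) {s : (KvBar v)ˣ} {N : ℕ} (hN : N.Coprime (residueChar v))
    (hsN : s ^ N = 1) (hs : spectralAbs v (s : KvBar v) = 1)
    (hs' : ∀ τ' : KvBar v ≃ₐ[Kv v] KvBar v, (∀ x, τ' (ι x) = ι x) → unitsAut τ' s = s) :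
    unitsAut τ s = s := by
  have h1 := spectralAbs_sub_lt_one_of_mem_inertia hι hσ hτ hs.le
    fun τ' h ↦ congrArg Units.val (hs' τ' h)
  rw [← div_eq_one]
  ext
  refine AbsoluteValue.eq_one_of_pow_eq_one (isNonarchimedean_spectralAbs v)
    (spectralAbs_natCast_eq_one v hN) ?_ ?_
  · rw [← Units.val_pow_eq_pow_val, div_pow, ← map_pow, hsN, map_one, div_one, Units.val_one]
  · rwa [Units.val_div_eq_div_val, coe_unitsAut, div_sub_one s.ne_zero, map_div₀, hs, div_one]

end TateLemma

theorem mainTheorem6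
    {K L M : Type*} [Field K] [NumberField K] [Field L] [NumberField L] [Field M] [NumberField M]
    [Algebra K L] [Algebra K M] [Algebra L M] [IsScalarTower K L M]
    (E : WeierstrassCurve K) [E.IsElliptic]
    (v : HeightOneSpectrum (𝓞 K)) (hE : TateLemma.HasSplitMultReductionAt E v)
    (hζ₄ : ∃ ζ : K, IsPrimitiveRoot ζ 4)
    (hζp : ∃ ζ : K, IsPrimitiveRoot ζ (TateLemma.residueChar v))
    (q : (TateLemma.Kv v)ˣ)
    (φ : Additive (TateLemma.KvBar v)ˣ →+ (E.baseChange (TateLemma.KvBar v)).toAffine.Point)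
    (hφ : TateLemma.IsTateUniformization E v q φ)
    (l : ℕ) (hl : l.Prime) [IsGalois L M] (hdeg : Module.finrank L M = l)
    (w : HeightOneSpectrum (𝓞 M)) (hw : w.asIdeal.LiesOver v.asIdeal)
    (ι : M →ₐ[K] TateLemma.KvBar v)
    (hι : ∀ x : M, TateLemma.placeAbs w x = TateLemma.closureAbs v (ι x))
    (σ : Gal(M/L)) (hσ : σ ∈ w.asIdeal.inertia Gal(M/L))
    (Q : (E.baseChange M).toAffine.Point)
    (hQ : IsOfFinAddOrder (Affine.Point.map (W' := E) σ.toAlgHom Q - Q)) :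
    (∀ ζ : (TateLemma.KvBar v)ˣ, IsPrimitiveRoot ζ l →
      Affine.Point.map (W' := E) ι (Affine.Point.map (W' := E) σ.toAlgHom Q - Q) ∈
        AddSubgroup.zmultiples (φ (Additive.ofMul ζ))) ∧
    (∀ ζ ζ' : (TateLemma.KvBar v)ˣ, IsPrimitiveRoot ζ l → IsPrimitiveRoot ζ' l →
      AddSubgroup.zmultiples (φ (Additive.ofMul ζ)) =
        AddSubgroup.zmultiples (φ (Additive.ofMul ζ'))) := by
  have : NeZero l := ⟨hl.ne_zero⟩
  have hmem : ∀ ζ t : (TateLemma.KvBar v)ˣ, IsPrimitiveRoot ζ l → t ^ l = 1 →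
      φ (Additive.ofMul t) ∈ AddSubgroup.zmultiples (φ (Additive.ofMul ζ)) := by
    intro ζ t hζ ht
    have h1 : t ∈ Subgroup.zpowers ζ := by
      rw [hζ.zpowers_eq]
      exact (mem_rootsOfUnity l t).2 ht
    obtain ⟨i, rfl⟩ := h1
    exact ⟨i, by simp⟩
  refine ⟨fun ζ hζ ↦ ?_, fun ζ ζ' hζ hζ' ↦ le_antisymm
    ((AddSubgroup.zmultiples_le).2 (hmem _ _ hζ' hζ.pow_eq_one))
    ((AddSubgroup.zmultiples_le).2 (hmem _ _ hζ hζ'.pow_eq_one))⟩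
  have : FiniteDimensional K M := Module.Finite.of_restrictScalars_finite ℚ K M
  -- Inertia preserves the absolute value of `w`, so `ι` and `ι ∘ σ` induce the same one on `M`.
  obtain ⟨τ, hτ⟩ := TateLemma.exists_algEquiv_of_spectralAbs_eq v ι
    (ι.comp (σ.toAlgHom.restrictScalars K)) fun x ↦ by
      rw [← TateLemma.closureAbs_inj, ← hι]
      refine (hι (σ x)).symm.trans ?_
      rw [TateLemma.placeAbs, TateLemma.placeAbs, TateLemma.adicAbv_apply_of_mem_inertia w hσ]
  replace hτ : ∀ x, τ (ι x) = ι (σ x) := hτ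
  obtain ⟨u, hu⟩ := hφ.surjective (Affine.Point.map (W' := E) ι Q)
  obtain ⟨u, rfl⟩ := Additive.ofMul.surjective u
  have hP : φ (Additive.ofMul (TateLemma.unitsAut τ u / u)) =
      Affine.Point.map (W' := E) ι (Affine.Point.map (W' := E) σ.toAlgHom Q - Q) := by
    rw [ofMul_div, map_sub, hφ.equivariant, hu, map_sub,
      TateLemma.point_map_algEquiv ι σ.toAlgHom hτ]
  have habs := TateLemma.spectralAbs_unitsAut_div τ u
  rw [← hP]
  refine hmem ζ _ hζ (Units.pow_eq_one_of_norm_eq_one (TateLemma.residueChar_prime v) hl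
    (TateLemma.unitsAut τ) ?_ ?_ ?_ ?_ ?_)
  · obtain ⟨n, hn, hn0⟩ := isOfFinAddOrder_iff_nsmul_eq_zero.1 hQ
    refine isOfFinOrder_iff_pow_eq_one.2 ⟨n, hn, hφ.eq_one_of_map_eq_zero ?_ ?_⟩
    · rw [ofMul_pow, map_nsmul, hP, ← map_nsmul, hn0, map_zero]
    · rw [Units.val_pow_eq_pow_val, map_pow, habs, one_pow]
  -- Since `σ ^ l = 1`, `τ ^ l` fixes `ι Q`, hence its lift `u`; the norm of `τ u / u` telescopes to
  -- `τ ^ l u / u`.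
  · have hfix : TateLemma.unitsAut (τ ^ l) u = u := by
      apply hφ.unitsAut_eq_of_map_eq
      have hσl : σ ^ l = 1 := by
        rw [← hdeg, ← IsGalois.card_aut_eq_finrank]
        exact pow_card_eq_one'
      have hpow : ∀ (n : ℕ) (x : M), (τ ^ n) (ι x) = ι ((σ ^ n) x) := by
        intro n
        induction n with
        | zero => intro x; rfl
        | succ n ih =>
          intro x
          rw [pow_succ', pow_succ', AlgEquiv.mul_apply, AlgEquiv.mul_apply, ih, hτ]
      rw [hu, TateLemma.point_map_algEquiv ι (AlgHom.id L M) (fun x ↦ by rw [hpow, hσl]; rfl)]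
      rcases Q with _ | _ <;> rfl
    calc ∏ i ∈ Finset.range l, (TateLemma.unitsAut τ)^[i] (TateLemma.unitsAut τ u / u)
        = ∏ i ∈ Finset.range l,
            ((TateLemma.unitsAut τ)^[i + 1] u / (TateLemma.unitsAut τ)^[i] u) :=
          Finset.prod_congr rfl fun i _ ↦ by
            rw [iterate_map_div, Function.iterate_succ_apply]
      _ = 1 := by
          rw [Finset.prod_range_div fun i ↦ (TateLemma.unitsAut τ)^[i] u, ← TateLemma.unitsAut_pow_apply, hfix]
          exact div_self' u
  · intro j N hN hjN
    refine TateLemma.unitsAut_eq_of_mem_inertia hι hσ hτ hN hjN ?_ fun τ' hτ' ↦ ?_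
    · rw [Units.val_pow_eq_pow_val, map_pow, habs, one_pow]
    · rw [map_pow]
      congr 1
      -- The point `ι (σ Q - Q)` has coordinates in `ι M`, so `τ'` fixes it and therefore fixes its
      -- lift.
      apply hφ.unitsAut_eq_of_map_eq
      rw [hP, TateLemma.point_map_algEquiv ι (AlgHom.id L M) hτ']
      congr 1
      generalize Affine.Point.map (W' := E) σ.toAlgHom Q - Q = P
      rcases P with _ | _ <;> rfl
  · have : NeZero (TateLemma.residueChar v) := ⟨(TateLemma.residueChar_prime v).ne_zero⟩
    exact fun x hx ↦ TateLemma.unitsAut_eq_of_pow_eq_one hζp τ hx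
  · exact fun _ x hx ↦ TateLemma.unitsAut_eq_of_pow_eq_one hζ₄ τ hx
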